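/- For a finite connected simple (unweighted) graph $G=(V,E)$, consider the simple random walk on $G$, which at each step moves to a uniformly random neighbour of its current vertex (for the one-vertex graph the walk stays put). Let $H_G(u,v)$ be the expected number of steps the walk started at $u$ takes until it first visits $v$ (so $H_G(u,u)=0$), let $\pi_G$ be the stationary distribution of the walk, and define the average hitting time and Kemeny's constant by $$\alpha(G)=\frac{1}{|V|^2}\sum_{u\in V}\sum_{v\in V}H_G(u,v),\qquad \kappa(G)=\sum_{v\in V}H_G(u,v)\,\pi_G(v),$$ where the value of $\kappa(G)$ does not depend on the choice of the starting vertex $u\in V$. Let $n\ge 1$, let $P_n$ be the path and $S_n$ the star on $n$ vertices. Then for every simple tree $T$ on $n$ vertices, all these quantities are finite, $\kappa(T)$ is independent of the starting vertex, and $$\alpha(S_n)\le\alpha(T)\le\alpha(P_n),\qquad \kappa(S_n)\le\kappa(T)\le\kappa(P_n).$$ Moreover, the path is the only maximizer and the star is the only minimizer: equality in either of the two upper bounds holds if and only if $T$ is isomorphic to $P_n$, and equality in either of the two lower bounds holds if and only if $T$ is isomorphic to $S_n$. -/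

import Mathlib

open MeasureTheory ProbabilityTheory
open scoped ENNReal

namespace SimpleGraph

open Classical in
/-- The one-step law of the simple random walk at `u`: a uniformly random neighbour of `u`.
A vertex without neighbours, where there is no neighbour to choose, is taken to be absorbing;
in a connected graph this only concerns the graph with one vertex. -/
noncomputable def walkStep {V : Type*} [Fintype V] (G : SimpleGraph V) (u : V) : PMF V :=
  if h : (Finset.univ.filter (G.Adj u)).Nonempty then
    PMF.uniformOfFinset (Finset.univ.filter (G.Adj u)) h
  else PMF.pure u

/-- The one-step law of the simple random walk as a Markov kernel. -/
noncomputable def walkKernel {V : Type*} [Fintype V] [MeasurableSpace V]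
    [DiscreteMeasurableSpace V] (G : SimpleGraph V) : Kernel V V where
  toFun u := (G.walkStep u).toMeasure
  measurable' := Measurable.of_discrete

instance {V : Type*} [Fintype V] [MeasurableSpace V] [DiscreteMeasurableSpace V]
    (G : SimpleGraph V) : IsMarkovKernel G.walkKernel :=
  ⟨fun u => inferInstanceAs (IsProbabilityMeasure (G.walkStep u).toMeasure)⟩

/-- The law, on the space of trajectories `ℕ → V`, of the simple random walk on `G` started
at `u`. -/
noncomputable def walkLaw {V : Type*} [Fintype V] [MeasurableSpace V]
    [DiscreteMeasurableSpace V] (G : SimpleGraph V) (u : V) : Measure (ℕ → V) :=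
  Kernel.traj (X := fun _ => V)
    (fun n => G.walkKernel.comap
      (fun x : (Finset.Iic n → V) => x ⟨n, Finset.mem_Iic.2 le_rfl⟩) (measurable_pi_apply _))
    0 (fun _ => u)

/-- The hitting time `H_G(u, v)`: the expectation of the first time `t ≥ 0` at which the simple
random walk started at `u` is at `v` (this time is `∞` on trajectories that never visit `v`). -/
noncomputable def hittingTime {V : Type*} [Fintype V] (G : SimpleGraph V) (u v : V) : ℝ≥0∞ :=
  letI : MeasurableSpace V := ⊤
  ∫⁻ ω, ENat.toENNReal (hittingAfter (fun (t : ℕ) (ω : ℕ → V) => ω t) {v} 0 ω) ∂(G.walkLaw u)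

/-- The average hitting time `α(G) = |V|⁻² ∑ u, ∑ v, H_G(u, v)`. -/
noncomputable def averageHittingTime {V : Type*} [Fintype V] (G : SimpleGraph V) : ℝ≥0∞ :=
  (∑ u, ∑ v, G.hittingTime u v) / (Fintype.card V : ℝ≥0∞) ^ 2

/-- `π` is a stationary distribution of the simple random walk: `πᵀ P = πᵀ`. -/
def IsStationary {V : Type*} [Fintype V] (G : SimpleGraph V) (π : PMF V) : Prop :=
  ∀ v, ∑ u, π u * G.walkStep u v = π v

theorem exists_isStationary {V : Type*} [Fintype V] [Nonempty V] (G : SimpleGraph V) :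
    ∃ π : PMF V, G.IsStationary π := by
  classical
  by_cases hE : ∃ u v, G.Adj u v
  · let d : V → ℝ≥0∞ := fun u => ((Finset.univ.filter (G.Adj u)).card : ℝ≥0∞)
    have h0 : tsum d ≠ 0 := by
      obtain ⟨u, v, huv⟩ := hE
      intro h
      have h1 := ENNReal.tsum_eq_zero.1 h u
      have h2 : (Finset.univ.filter (G.Adj u)).card = 0 := by exact_mod_cast h1
      have h3 : v ∈ Finset.univ.filter (G.Adj u) := by simpa using huv
      rw [Finset.card_eq_zero] at h2
      rw [h2] at h3
      simp at h3
    have htop : tsum d ≠ ⊤ := by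
      rw [tsum_fintype]
      exact ENNReal.sum_ne_top.2 fun u _ => ENNReal.natCast_ne_top _
    refine ⟨PMF.normalize d h0 htop, fun v => ?_⟩
    have key : ∀ u, d u * G.walkStep u v = if G.Adj v u then 1 else 0 := by
      intro u
      by_cases hne : (Finset.univ.filter (G.Adj u)).Nonempty
      · have hc : d u ≠ 0 := by
          simp only [d]
          exact_mod_cast (Finset.card_pos.2 hne).ne'
        rw [walkStep, dif_pos hne, PMF.uniformOfFinset_apply]
        by_cases ha : G.Adj u v
        · simp only [Finset.mem_filter, Finset.mem_univ, true_and, ha, if_true, ha.symm]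
          exact ENNReal.mul_inv_cancel hc (ENNReal.natCast_ne_top _)
        · have ha' : ¬ G.Adj v u := fun h => ha h.symm
          simp [ha, ha']
      · have hz : d u = 0 := by
          simp only [d]
          rw [Finset.not_nonempty_iff_eq_empty.1 hne]
          simp
        have ha' : ¬ G.Adj v u := fun h => hne ⟨v, by simpa using h.symm⟩
        simp [hz, ha']
    calc ∑ u, PMF.normalize d h0 htop u * G.walkStep u v
        = ∑ u, (d u * G.walkStep u v) * (tsum d)⁻¹ := by
          refine Finset.sum_congr rfl fun u _ => ?_
          rw [PMF.normalize_apply]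
          ring
      _ = d v * (tsum d)⁻¹ := by
          rw [← Finset.sum_mul]
          simp [key, d]
      _ = PMF.normalize d h0 htop v := by rw [PMF.normalize_apply]
  · refine ⟨PMF.pure (Classical.arbitrary V), fun v => ?_⟩
    have hs : ∀ u, G.walkStep u = PMF.pure u := by
      intro u
      rw [walkStep, dif_neg]
      rintro ⟨w, hw⟩
      exact hE ⟨u, w, by simpa using hw⟩
    simp [hs, PMF.pure_apply]

/-- The stationary distribution of the simple random walk (it is unique if `G` is connected). -/
noncomputable def stationary {V : Type*} [Fintype V] [Nonempty V] (G : SimpleGraph V) : PMF V :=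
  G.exists_isStationary.choose

/-- Kemeny's constant `κ(G) = ∑ v, H_G(u, v) π_G(v)`, computed from the starting vertex `u`. -/
noncomputable def kemeny {V : Type*} [Fintype V] (G : SimpleGraph V) (u : V) : ℝ≥0∞ :=
  haveI : Nonempty V := ⟨u⟩
  ∑ v, G.hittingTime u v * G.stationary v

end SimpleGraph

/-!
In a tree, the Laplacian of `d(w, ·)` is `2 - deg` away from `w`, so the hitting time of `v` from
`u`, being the solution of the first-step equations, is
`½ ∑ w, deg w * (d(u, v) + d(v, w) - d(u, w))`. Summing this formula expresses both parameters
through the sum `W` of all distances: `α = (n - 1) W / n²`, and `κ = W / (n - 1) - n + 1 / 2` for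
`n ≥ 2`. Hence it suffices to find the extremal trees for `W`.

In a connected graph the distances from a vertex leave no gaps, so their sum is at most
`n (n - 1) / 2`, with equality only if they are pairwise distinct, that is, in a path with this
vertex at one end. Deleting a non-cut vertex and inducting, `W` is largest for the path. In the
other direction, two distinct vertices are at distance `1` if adjacent and at least `2` otherwise;
all trees have the same number of edges, so `W` is smallest exactly when no distance exceeds `2`,
which characterises the star.
-/

namespace TreeWalk

open SimpleGraph
open scoped Finset

section MarkovChain

variable {S : Type*} {A : Set S}

/-- The event that a trajectory stays outside `A` up to and including time `k`. -/
def avoiding (A : Set S) (k : ℕ) : Set (ℕ → S) :=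
  {ω | ∀ i ≤ k, ω i ∉ A}

theorem avoiding_succ (k : ℕ) :
    avoiding A (k + 1) = avoiding A k ∩ {ω | ω (k + 1) ∉ A} := by
  ext ω
  simp [avoiding, Nat.le_add_one_iff, or_imp, forall_and]

variable [MeasurableSpace S]

theorem measurableSet_avoiding (hA : MeasurableSet A) (k : ℕ) :
    MeasurableSet (avoiding A k) := by
  simp only [avoiding, Set.ofPred_forall]
  exact .iInter fun i => .iInter fun _ => hA.compl.preimage (measurable_pi_apply i)

variable (κ : Kernel S S) [IsMarkovKernel κ]

/-- The law, on the space of trajectories `ℕ → S`, of the Markov chain with transition kernel `κ`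
started at `x`; `SimpleGraph.walkLaw` is the case of the walk kernel. -/
noncomputable def chainLaw (x : S) : Measure (ℕ → S) :=
  Kernel.traj (X := fun _ => S)
    (fun n => κ.comap (fun y : Finset.Iic n → S => y ⟨n, Finset.mem_Iic.2 le_rfl⟩)
      (measurable_pi_apply _)) 0 (fun _ => x)

instance (x : S) : IsProbabilityMeasure (chainLaw κ x) := by
  unfold chainLaw
  infer_instance

theorem lintegral_chainLaw_zero (x : S) {f : S → ℝ≥0∞} (hf : Measurable f) :
    ∫⁻ ω, f (ω 0) ∂chainLaw κ x = f x := by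
  have h0 : ∀ ω : ℕ → S, Function.updateFinset ω (Finset.Iic 0) (fun _ => x) 0 = x := fun ω => by
    simp [Function.updateFinset]
  rw [chainLaw, Kernel.lintegral_traj _ (by fun_prop)]
  simp only [h0, lintegral_const, measure_univ, mul_one]

theorem lintegral_chainLaw_succ (x : S) (k : ℕ) {F : (Finset.Iic k → S) × S → ℝ≥0∞}
    (hF : Measurable F) :
    ∫⁻ ω, F (Preorder.frestrictLe k ω, ω (k + 1)) ∂chainLaw κ x =
      ∫⁻ ω, ∫⁻ y, F (Preorder.frestrictLe k ω, y) ∂κ (ω k) ∂chainLaw κ x := by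
  have hlaw := Kernel.partialTraj_compProd_eq_map_traj (X := fun _ => S)
    (κ := fun n => κ.comap (fun y : Finset.Iic n → S => y ⟨n, Finset.mem_Iic.2 le_rfl⟩)
      (measurable_pi_apply _)) (Nat.zero_le k) (x₀ := fun _ => x)
  rw [← Kernel.traj_map_frestrictLe_apply] at hlaw
  calc ∫⁻ ω, F (Preorder.frestrictLe k ω, ω (k + 1)) ∂chainLaw κ x
      = ∫⁻ p, F p ∂(chainLaw κ x).map (fun ω => (Preorder.frestrictLe k ω, ω (k + 1))) :=
        (lintegral_map hF (by fun_prop)).symm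
    _ = ∫⁻ ω, ∫⁻ y, F (Preorder.frestrictLe k ω, y) ∂κ (ω k) ∂chainLaw κ x := by
        rw [chainLaw, ← hlaw, Measure.lintegral_compProd hF,
          lintegral_map hF.lintegral_kernel_prod_right' (by fun_prop)]
        rfl

theorem lintegral_avoiding_zero (x : S) (hA : MeasurableSet A) {f : S → ℝ≥0∞} (hf : Measurable f)
    (hfA : ∀ y ∈ A, f y = 0) :
    ∫⁻ ω in avoiding A 0, f (ω 0) ∂chainLaw κ x = f x := by
  rw [← lintegral_chainLaw_zero κ x hf, ← lintegral_indicator (measurableSet_avoiding hA 0)]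
  refine lintegral_congr fun ω => Set.indicator_apply_eq_self.2 fun hω => hfA _ ?_
  simpa [avoiding] using hω

theorem lintegral_avoiding_succ (x : S) (hA : MeasurableSet A) (k : ℕ) {f : S → ℝ≥0∞}
    (hf : Measurable f) (hfA : ∀ y ∈ A, f y = 0) :
    ∫⁻ ω in avoiding A (k + 1), f (ω (k + 1)) ∂chainLaw κ x =
      ∫⁻ ω in avoiding A k, ∫⁻ y, f y ∂κ (ω k) ∂chainLaw κ x := by
  classical
  let B : Set (Finset.Iic k → S) := {y | ∀ i, y i ∉ A}
  have hB : MeasurableSet B := by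
    simp only [B, Set.ofPred_forall]
    exact .iInter fun i => hA.compl.preimage (measurable_pi_apply i)
  have hmem (ω : ℕ → S) : Preorder.frestrictLe (π := fun _ => S) k ω ∈ B ↔ ω ∈ avoiding A k := by
    simp [B, avoiding, Preorder.frestrictLe, Finset.restrict]
  let F : (Finset.Iic k → S) × S → ℝ≥0∞ := (Prod.fst ⁻¹' B).indicator (f ∘ Prod.snd)
  have hF : Measurable F := (hf.comp measurable_snd).indicator (measurable_fst hB)
  rw [← lintegral_indicator (measurableSet_avoiding hA _),
    ← lintegral_indicator (measurableSet_avoiding hA _)]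
  convert lintegral_chainLaw_succ κ x k hF using 1
  · refine lintegral_congr fun ω => ?_
    by_cases hω : ω ∈ avoiding A k <;> by_cases hA' : ω (k + 1) ∈ A <;>
      simp [F, avoiding_succ, hmem, hω, hA', hfA]
  · refine lintegral_congr fun ω => ?_
    by_cases hω : ω ∈ avoiding A k <;> simp [F, hmem, hω]

theorem toENNReal_eq_tsum_indicator {n : ℕ∞} {s : Set ℕ} (h : ∀ k : ℕ, n ≤ k ↔ k ∉ s) :
    (n : ℝ≥0∞) = ∑' k : ℕ, s.indicator 1 k := by
  have hcard : s.encard = n := by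
    induction n using ENat.recTopCoe with
    | top =>
      have hs : s = Set.univ := Set.eq_univ_of_forall fun k => by simpa using h k
      simp [hs]
    | coe n =>
      have hs : s = Finset.range n := by
        ext k
        simpa using (not_congr (h k)).symm
      rw [hs, Set.encard_coe_eq_coe_finsetCard, Finset.card_range]
  rw [← hcard, ← ENNReal.tsum_set_one]
  exact tsum_subtype s 1

theorem lintegral_hittingAfter_eq_tsum (x : S) (hA : MeasurableSet A) :
    ∫⁻ ω, ENat.toENNReal (hittingAfter (fun (t : ℕ) (ω : ℕ → S) => ω t) A 0 ω) ∂chainLaw κ x =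
      ∑' k, chainLaw κ x (avoiding A k) := by
  simp only [← lintegral_indicator_one (measurableSet_avoiding hA _)]
  rw [← lintegral_tsum fun k =>
    (measurable_one.indicator (measurableSet_avoiding hA k)).aemeasurable]
  refine lintegral_congr fun ω =>
    toENNReal_eq_tsum_indicator (s := {k | ω ∈ avoiding A k}) fun k => ?_
  refine (hittingAfter_le_iff (u := fun (t : ℕ) (ω : ℕ → S) => ω t)).trans ?_
  simp [avoiding]

theorem eq_sum_measure_avoiding_add {h : S → ℝ≥0∞} (hA : MeasurableSet A) (hh : Measurable h)
    (hhA : ∀ x ∈ A, h x = 0) (hstep : ∀ x ∉ A, h x = 1 + ∫⁻ y, h y ∂κ x) (x : S) (n : ℕ) :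
    h x = ∑ k ∈ Finset.range n, chainLaw κ x (avoiding A k) +
      ∫⁻ ω in avoiding A n, h (ω n) ∂chainLaw κ x := by
  induction n with
  | zero => simp [lintegral_avoiding_zero κ x hA hh hhA]
  | succ n ih =>
    have hn : ∫⁻ ω in avoiding A n, h (ω n) ∂chainLaw κ x =
        chainLaw κ x (avoiding A n) +
          ∫⁻ ω in avoiding A n, ∫⁻ y, h y ∂κ (ω n) ∂chainLaw κ x := by
      rw [setLIntegral_congr_fun (measurableSet_avoiding hA n)
        fun ω hω => hstep (ω n) (hω n le_rfl), lintegral_add_left measurable_const,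
        setLIntegral_one]
    rw [Finset.sum_range_succ, add_assoc, lintegral_avoiding_succ κ x hA n hh hhA, ← hn]
    exact ih

theorem lintegral_hittingAfter_eq_of_firstStep {h : S → ℝ≥0∞} (hA : MeasurableSet A)
    (hh : Measurable h) (hhA : ∀ x ∈ A, h x = 0) (hstep : ∀ x ∉ A, h x = 1 + ∫⁻ y, h y ∂κ x)
    {C : ℝ≥0∞} (hC : C ≠ ∞) (hle : ∀ x, h x ≤ C) (x : S) :
    ∫⁻ ω, ENat.toENNReal (hittingAfter (fun (t : ℕ) (ω : ℕ → S) => ω t) A 0 ω) ∂chainLaw κ x =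
      h x := by
  rw [lintegral_hittingAfter_eq_tsum κ x hA]
  have hsum := eq_sum_measure_avoiding_add κ hA hh hhA hstep x
  have hfin : ∑' k, chainLaw κ x (avoiding A k) ≠ ∞ := by
    refine ne_top_of_le_ne_top (ne_top_of_le_ne_top hC (hle x)) ?_
    rw [ENNReal.tsum_eq_iSup_nat]
    exact iSup_le fun n => (hsum n).symm ▸ le_self_add
  have hupper : Filter.Tendsto (fun n => C * chainLaw κ x (avoiding A n))
      Filter.atTop (nhds 0) := by
    simpa using ENNReal.Tendsto.const_mul (ENNReal.tendsto_atTop_zero_of_tsum_ne_top hfin) (.inr hC)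
  have hrem : Filter.Tendsto (fun n => ∫⁻ ω in avoiding A n, h (ω n) ∂chainLaw κ x)
      Filter.atTop (nhds 0) :=
    tendsto_of_tendsto_of_tendsto_of_le_of_le tendsto_const_nhds hupper (fun _ => zero_le) fun n =>
      (lintegral_mono fun ω : ℕ → S => hle (ω n)).trans_eq (setLIntegral_const _ C)
  have hlim := (ENNReal.tendsto_nat_tsum fun k => chainLaw κ x (avoiding A k)).add hrem
  simp only [← hsum, add_zero] at hlim
  exact tendsto_nhds_unique hlim tendsto_const_nhds

end MarkovChain

section SimpleRandomWalk

variable {V : Type*} [Fintype V] {G : SimpleGraph V}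

theorem lintegral_walkKernel [MeasurableSpace V] [DiscreteMeasurableSpace V] (u : V)
    (f : V → ℝ≥0∞) : ∫⁻ w, f w ∂G.walkKernel u = ∑ w, G.walkStep u w * f w := by
  rw [lintegral_fintype]
  refine Finset.sum_congr rfl fun w _ => ?_
  rw [mul_comm]
  exact congrArg (· * f w) (PMF.toMeasure_apply_singleton _ _ (measurableSet_singleton w))

theorem hittingTime_eq_of_firstStep {v : V} {h : V → ℝ≥0∞} (hfin : ∀ x, h x ≠ ∞) (hv : h v = 0)
    (hstep : ∀ x ≠ v, h x = 1 + ∑ w, G.walkStep x w * h w) (u : V) :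
    G.hittingTime u v = h u := by
  let _ : MeasurableSpace V := ⊤
  refine lintegral_hittingAfter_eq_of_firstStep G.walkKernel (measurableSet_singleton v)
    Measurable.of_discrete (by simpa using hv) (fun x hx => ?_)
    (ENNReal.sum_ne_top.2 fun x _ => hfin x)
    (fun x => Finset.single_le_sum (fun _ _ => zero_le) (Finset.mem_univ x)) u
  rw [lintegral_walkKernel]
  exact hstep x hx

variable [DecidableRel G.Adj]

theorem walkStep_apply_of_degree_pos {u : V} (hu : 0 < G.degree u) (w : V) :
    G.walkStep u w = if G.Adj u w then (G.degree u : ℝ≥0∞)⁻¹ else 0 := by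
  classical
  have hne : (Finset.univ.filter (G.Adj u)).Nonempty := by
    rwa [← Finset.card_pos, ← neighborFinset_eq_filter]
  have hcard : (Finset.univ.filter (G.Adj u)).card = G.degree u := by
    rw [← neighborFinset_eq_filter, card_neighborFinset_eq_degree]
  have hstep : G.walkStep u = PMF.uniformOfFinset _ hne := by
    rw [walkStep]
    convert! dif_pos hne
    infer_instance
  simp [hstep, PMF.uniformOfFinset_apply, hcard]

theorem sum_walkStep_mul_ofReal {u : V} (hu : 0 < G.degree u) {h : V → ℝ} (hh : 0 ≤ h) :
    ∑ w, G.walkStep u w * ENNReal.ofReal (h w) =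
      ENNReal.ofReal ((∑ w ∈ G.neighborFinset u, h w) / G.degree u) := by
  rw [ENNReal.ofReal_div_of_pos (by exact_mod_cast hu), ENNReal.ofReal_natCast,
    ENNReal.ofReal_sum_of_nonneg fun w _ => hh w, div_eq_mul_inv, mul_comm, Finset.mul_sum,
    neighborFinset_eq_filter, Finset.sum_filter]
  exact Finset.sum_congr rfl fun w _ => by rw [walkStep_apply_of_degree_pos hu, ite_mul, zero_mul]

theorem hittingTime_eq_ofReal [DecidableEq V] (hG : G.Connected) {v : V} {h : V → ℝ}
    (hh : 0 ≤ h) (hv : h v = 0) (hlap : ∀ u ≠ v, (G.lapMatrix ℝ).mulVec h u = G.degree u) (u : V) :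
    G.hittingTime u v = ENNReal.ofReal (h u) := by
  refine hittingTime_eq_of_firstStep (h := fun u => ENNReal.ofReal (h u))
    (fun _ => ENNReal.ofReal_ne_top) (by simp [hv]) (fun x hx => ?_) u
  have hdeg : 0 < G.degree x := (hG x v).degree_pos_left hx
  rw [sum_walkStep_mul_ofReal hdeg hh, ← ENNReal.ofReal_one, ← ENNReal.ofReal_add zero_le_one
    (div_nonneg (Finset.sum_nonneg fun w _ => hh w) (Nat.cast_nonneg _))]
  have hx' := hlap x hx
  rw [lapMatrix_mulVec_apply] at hx'
  congr 1
  field_simp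
  linarith

theorem lapMatrix_mulVec_div_degree [DecidableEq V] (hdeg : ∀ u, 0 < G.degree u) {π : PMF V}
    (hπ : G.IsStationary π) :
    (G.lapMatrix ℝ).mulVec (fun u => (π u).toReal / G.degree u) = 0 := by
  ext v
  have hv : (G.degree v : ℝ) ≠ 0 := by exact_mod_cast (hdeg v).ne'
  rw [lapMatrix_mulVec_apply, mul_div_cancel₀ _ hv, Pi.zero_apply, sub_eq_zero, ← hπ v,
    ENNReal.toReal_sum fun u _ => ENNReal.mul_ne_top (π.apply_ne_top u) (PMF.apply_ne_top _ v),
    neighborFinset_eq_filter, Finset.sum_filter]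
  refine Finset.sum_congr rfl fun u _ => ?_
  simp only [walkStep_apply_of_degree_pos (hdeg u), G.adj_comm v u]
  split_ifs <;> simp [div_eq_mul_inv]

theorem toReal_apply_of_isStationary [Nontrivial V] (hG : G.Connected) {π : PMF V}
    (hπ : G.IsStationary π) (v : V) :
    (π v).toReal = G.degree v / ∑ u, (G.degree u : ℝ) := by
  classical
  have hdeg (u : V) : 0 < G.degree u := hG.preconnected.degree_pos_of_nontrivial u
  have hconst (u : V) : (π u).toReal = (π v).toReal / G.degree v * G.degree u := by
    have hu : (G.degree u : ℝ) ≠ 0 := by exact_mod_cast (hdeg u).ne'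
    rw [← (lapMatrix_mulVec_eq_zero_iff_forall_reachable G).1
      (lapMatrix_mulVec_div_degree hdeg hπ) u v (hG u v), div_mul_cancel₀ _ hu]
  have hone : ∑ u, (π u).toReal = 1 := by
    rw [← ENNReal.toReal_sum fun u _ => π.apply_ne_top u, ← tsum_fintype (L := .unconditional V),
      π.tsum_coe, ENNReal.toReal_one]
  rw [Finset.sum_congr rfl fun u _ => hconst u, ← Finset.mul_sum] at hone
  have hv : (G.degree v : ℝ) ≠ 0 := by exact_mod_cast (hdeg v).ne'
  rw [div_mul_eq_mul_div, div_eq_one_iff_eq hv] at hone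
  exact eq_div_of_mul_eq (fun h0 => hv (by rw [← hone, h0, mul_zero])) hone

end SimpleRandomWalk

section TreeDistance

variable {V : Type*} {G : SimpleGraph V}

theorem exists_adj_dist_eq_add_one (hG : G.Connected) {w u : V} (h : u ≠ w) :
    ∃ x, G.Adj x u ∧ G.dist w u = G.dist w x + 1 := by
  obtain ⟨p, hp⟩ := hG.exists_walk_length_eq_dist u w
  cases p with
  | nil => exact absurd rfl h
  | @cons _ x _ hux q =>
    have hle := dist_le q
    have htri := hG.dist_triangle (u := u) (v := x) (w := w)
    rw [dist_eq_one_iff_adj.2 hux] at htri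
    rw [Walk.length_cons] at hp
    refine ⟨x, hux.symm, ?_⟩
    rw [dist_comm, dist_comm (u := w)]
    lia

theorem existsUnique_adj_dist_eq_add_one (hG : G.IsTree) {w u : V} (h : u ≠ w) :
    ∃! x, G.Adj x u ∧ G.dist w u = G.dist w x + 1 := by
  have hshortest {x : V} (hx : G.Adj x u) (hxd : G.dist w u = G.dist w x + 1) :
      ∃ p : G.Path w u, p.1.penultimate = x := by
    obtain ⟨p, hp⟩ := hG.connected.exists_walk_length_eq_dist w x
    exact ⟨⟨p.concat hx, Walk.isPath_of_length_eq_dist _ (by rw [Walk.length_concat, hp, hxd])⟩,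
      p.penultimate_concat hx⟩
  obtain ⟨x, hx, hxd⟩ := exists_adj_dist_eq_add_one hG.connected h
  refine ⟨x, ⟨hx, hxd⟩, fun y ⟨hy, hyd⟩ => ?_⟩
  obtain ⟨p, rfl⟩ := hshortest hx hxd
  obtain ⟨q, rfl⟩ := hshortest hy hyd
  rw [(hG.isAcyclic.subsingleton_path w u).elim q p]

variable [Fintype V] [DecidableRel G.Adj]

theorem sum_degree_eq (hG : G.IsTree) : ∑ u, (G.degree u : ℝ) = 2 * (Fintype.card V - 1) := by
  classical
  have hedge : (G.edgeFinset.card : ℝ) + 1 = Fintype.card V := by exact_mod_cast hG.card_edgeFinset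
  have hsum := G.sum_degrees_eq_twice_card_edges
  rw [← hedge, add_sub_cancel_right]
  exact_mod_cast hsum

theorem lapMatrix_mulVec_dist [DecidableEq V] (hG : G.IsTree) (w u : V) :
    (G.lapMatrix ℝ).mulVec (fun x => (G.dist w x : ℝ)) u =
      2 - G.degree u - if u = w then 2 else 0 := by
  have hcard : (G.degree u : ℝ) * G.dist w u = ∑ _x ∈ G.neighborFinset u, (G.dist w u : ℝ) := by
    simp
  rw [lapMatrix_mulVec_apply, hcard, ← Finset.sum_sub_distrib]
  split_ifs with h
  · have hnbr : ∀ x ∈ G.neighborFinset u, (G.dist w u : ℝ) - G.dist w x = -1 := fun x hx => by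
      rw [h, dist_self, dist_eq_one_iff_adj.2 (by simpa [h] using hx)]
      simp
    rw [Finset.sum_congr rfl hnbr]
    simp
  · obtain ⟨y, ⟨hy, hyd⟩, huniq⟩ := existsUnique_adj_dist_eq_add_one hG h
    have hnbr : ∀ x ∈ G.neighborFinset u, (G.dist w u : ℝ) - G.dist w x =
        (if x = y then 2 else 0) - 1 := fun x hx => by
      rw [mem_neighborFinset] at hx
      split_ifs with hxy
      · rw [hxy, hyd]
        push_cast
        ring
      · have hlt : G.dist w x = G.dist w u + 1 :=
          (hG.dist_eq_dist_add_one_of_adj w hx).resolve_left fun hd => hxy (huniq x ⟨hx.symm, hd⟩)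
        rw [hlt]
        push_cast
        ring
    rw [Finset.sum_congr rfl hnbr]
    simp [hy.symm]

-- The Dirichlet energy of the distance to `w` is the number of edges.
theorem sum_degree_mul_dist (hG : G.IsTree) (w : V) :
    ∑ u, (G.degree u : ℝ) * G.dist w u = 2 * ∑ u, (G.dist w u : ℝ) - (Fintype.card V - 1) := by
  classical
  have henergy := lapMatrix_toLinearMap₂' ℝ G (fun u => (G.dist w u : ℝ))
  have hsq (u x : V) : (if G.Adj u x then ((G.dist w u : ℝ) - G.dist w x) ^ 2 else 0) =
      if G.Adj u x then 1 else 0 := by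
    split_ifs with h
    · rcases hG.dist_eq_dist_add_one_of_adj w h with hd | hd <;> simp [hd]
    · rfl
  have hpair (u : V) : (G.dist w u : ℝ) * (2 - G.degree u - if u = w then 2 else 0) =
      2 * G.dist w u - G.degree u * G.dist w u := by
    split_ifs with h
    · simp [h]
    · ring
  simp only [Matrix.toLinearMap₂'_apply', dotProduct, lapMatrix_mulVec_dist hG, hpair, hsq,
    ← degree_eq_sum_if_adj, sum_degree_eq hG, Finset.sum_sub_distrib, ← Finset.mul_sum] at henergy
  linarith

end TreeDistance

section TreeHittingTime

variable {V : Type*} [Fintype V] (G : SimpleGraph V) [DecidableRel G.Adj]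

/-- The distance formula `½ ∑ w, deg w * (d(u, v) + d(v, w) - d(u, w))` for the hitting time of `v`
from `u` in a tree. -/
noncomputable def treeHittingTime (u v : V) : ℝ :=
  (∑ w, (G.degree w : ℝ) * (G.dist v u + G.dist v w - G.dist w u)) / 2

theorem treeHittingTime_self (v : V) : treeHittingTime G v v = 0 := by
  simp [treeHittingTime, dist_comm (u := v)]

variable {G}

theorem treeHittingTime_nonneg (hG : G.Connected) (u v : V) : 0 ≤ treeHittingTime G u v := by
  refine div_nonneg (Finset.sum_nonneg fun w _ => mul_nonneg (Nat.cast_nonneg _) ?_) two_pos.le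
  have htri : (G.dist w u : ℝ) ≤ G.dist w v + G.dist v u := by exact_mod_cast hG.dist_triangle
  rw [dist_comm (u := w) (v := v)] at htri
  linarith

theorem lapMatrix_mulVec_treeHittingTime [DecidableEq V] (hG : G.IsTree) {u v : V} (h : u ≠ v) :
    (G.lapMatrix ℝ).mulVec (fun x => treeHittingTime G x v) u = G.degree u := by
  have hlin : (fun x => treeHittingTime G x v) = (1 / 2 : ℝ) • ∑ w, (G.degree w : ℝ) •
      ((fun x => (G.dist v x : ℝ)) + (G.dist v w : ℝ) • (fun _ => 1) -
        fun x => (G.dist w x : ℝ)) := by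
    ext x
    simp [treeHittingTime, Finset.sum_apply, div_eq_inv_mul]
  simp only [hlin, Matrix.mulVec_smul, Matrix.mulVec_sum, Matrix.mulVec_sub, Matrix.mulVec_add,
    lapMatrix_mulVec_const_eq_zero, smul_zero, add_zero, Pi.smul_apply, Pi.sub_apply,
    Finset.sum_apply, lapMatrix_mulVec_dist hG, if_neg h]
  simp [inv_mul_eq_div]

theorem hittingTime_eq_treeHittingTime (hG : G.IsTree) (u v : V) :
    G.hittingTime u v = ENNReal.ofReal (treeHittingTime G u v) := by
  classical
  exact hittingTime_eq_ofReal hG.connected (fun x => treeHittingTime_nonneg hG.connected x v)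
    (treeHittingTime_self G v) (fun _ hx => lapMatrix_mulVec_treeHittingTime hG hx) u

end TreeHittingTime

section TotalDist

variable {V : Type*} [Fintype V] {G : SimpleGraph V}

/-- The sum of the distances of all ordered pairs of vertices, that is, twice the Wiener index. -/
noncomputable def totalDist (G : SimpleGraph V) : ℕ :=
  ∑ u, ∑ v, G.dist u v

theorem totalDist_eq_zero_of_subsingleton [Subsingleton V] : totalDist G = 0 :=
  Finset.sum_eq_zero fun u _ => Finset.sum_eq_zero fun v _ => by
    rw [Subsingleton.elim u v, dist_self]

theorem sum_sum_treeHittingTime [DecidableRel G.Adj] (hG : G.IsTree) :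
    ∑ u, ∑ v, treeHittingTime G u v = (Fintype.card V - 1) * totalDist G := by
  have hcancel (w : V) :
      ∑ u, ∑ v, ((G.dist v u : ℝ) + G.dist v w - G.dist w u) = totalDist G := by
    simp only [Finset.sum_sub_distrib, Finset.sum_add_distrib]
    rw [Finset.sum_comm (f := fun u v => (G.dist v u : ℝ))]
    simp [totalDist, dist_comm (u := w), ← Finset.mul_sum]
  calc ∑ u, ∑ v, treeHittingTime G u v
      = (∑ w, (G.degree w : ℝ) * ∑ u, ∑ v, ((G.dist v u : ℝ) + G.dist v w - G.dist w u)) / 2 := by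
        simp only [treeHittingTime, ← Finset.sum_div, Finset.mul_sum]
        exact congrArg (· / 2)
          ((Finset.sum_congr rfl fun u _ => Finset.sum_comm).trans Finset.sum_comm)
    _ = (Fintype.card V - 1) * totalDist G := by
        simp only [hcancel, ← Finset.sum_mul, sum_degree_eq hG]
        ring

theorem sum_degree_mul_sum_degree_mul_dist [DecidableRel G.Adj] (hG : G.IsTree) :
    ∑ v, (G.degree v : ℝ) * ∑ w, (G.degree w : ℝ) * G.dist v w =
      4 * totalDist G - 2 * (Fintype.card V - 1) * (2 * Fintype.card V - 1) := by
  have hswap : ∑ v, (G.degree v : ℝ) * ∑ w, (G.dist v w : ℝ) =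
      ∑ w, ∑ v, (G.degree v : ℝ) * G.dist w v := by
    simp only [Finset.mul_sum]
    rw [Finset.sum_comm]
    simp only [dist_comm]
  simp only [sum_degree_mul_dist hG, mul_sub, Finset.sum_sub_distrib, mul_left_comm _ (2 : ℝ),
    ← Finset.mul_sum, ← Finset.sum_mul, sum_degree_eq hG, hswap]
  simp [totalDist]
  ring

theorem sum_treeHittingTime_mul_degree [DecidableRel G.Adj] (hG : G.IsTree) (u : V) :
    ∑ v, treeHittingTime G u v * G.degree v =
      2 * totalDist G - (Fintype.card V - 1) * (2 * Fintype.card V - 1) := by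
  have hexpand (v : V) : treeHittingTime G u v * G.degree v =
      ((G.degree v : ℝ) * G.dist u v * ∑ w, (G.degree w : ℝ) +
        (G.degree v : ℝ) * ∑ w, (G.degree w : ℝ) * G.dist v w -
        (G.degree v : ℝ) * ∑ w, (G.degree w : ℝ) * G.dist u w) / 2 := by
    simp only [treeHittingTime, mul_sub, mul_add, Finset.sum_sub_distrib, Finset.sum_add_distrib,
      ← Finset.sum_mul, dist_comm (v := u)]
    ring
  simp only [hexpand, ← Finset.sum_div, Finset.sum_sub_distrib, Finset.sum_add_distrib,
    ← Finset.sum_mul, sum_degree_mul_sum_degree_mul_dist hG]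
  ring

theorem averageHittingTime_lt_top (hG : G.IsTree) : G.averageHittingTime < ∞ := by
  classical
  have : Nonempty V := hG.connected.nonempty
  refine ENNReal.div_lt_top (ENNReal.sum_ne_top.2 fun u _ => ENNReal.sum_ne_top.2 fun v _ => ?_)
    (by simp)
  exact hittingTime_eq_treeHittingTime hG u v ▸ ENNReal.ofReal_ne_top

theorem toReal_averageHittingTime (hG : G.IsTree) :
    G.averageHittingTime.toReal =
      (Fintype.card V - 1) * totalDist G / (Fintype.card V : ℝ) ^ 2 := by
  classical
  have hfin (u v : V) : G.hittingTime u v ≠ ∞ :=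
    hittingTime_eq_treeHittingTime hG u v ▸ ENNReal.ofReal_ne_top
  have hsum (u : V) : (∑ v, G.hittingTime u v).toReal = ∑ v, treeHittingTime G u v := by
    rw [ENNReal.toReal_sum fun v _ => hfin u v]
    simp only [hittingTime_eq_treeHittingTime hG,
      ENNReal.toReal_ofReal (treeHittingTime_nonneg hG.connected _ _)]
  rw [averageHittingTime, ENNReal.toReal_div,
    ENNReal.toReal_sum fun u _ => ENNReal.sum_ne_top.2 fun v _ => hfin u v]
  simp only [hsum, sum_sum_treeHittingTime hG, ENNReal.toReal_pow, ENNReal.toReal_natCast]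

theorem kemeny_lt_top (hG : G.IsTree) (u : V) : G.kemeny u < ∞ := by
  classical
  refine ENNReal.sum_lt_top.2 fun v _ => ENNReal.mul_lt_top ?_ (PMF.apply_lt_top _ v)
  exact hittingTime_eq_treeHittingTime hG u v ▸ ENNReal.ofReal_lt_top

theorem kemeny_eq_zero_of_subsingleton [Subsingleton V] (hG : G.IsTree) (u : V) :
    G.kemeny u = 0 := by
  classical
  refine Finset.sum_eq_zero fun v _ => ?_
  rw [Subsingleton.elim u v, hittingTime_eq_treeHittingTime hG, treeHittingTime_self]
  simp

theorem toReal_kemeny [Nontrivial V] (hG : G.IsTree) (u : V) :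
    (G.kemeny u).toReal =
      totalDist G / (Fintype.card V - 1) - Fintype.card V + 1 / 2 := by
  classical
  have hπ : G.IsStationary G.stationary := G.exists_isStationary.choose_spec
  have hterm (v : V) : (G.hittingTime u v * G.stationary v).toReal =
      treeHittingTime G u v * G.degree v / (2 * (Fintype.card V - 1)) := by
    rw [ENNReal.toReal_mul, hittingTime_eq_treeHittingTime hG,
      ENNReal.toReal_ofReal (treeHittingTime_nonneg hG.connected u v),
      toReal_apply_of_isStationary hG.connected hπ,
      sum_degree_eq hG, mul_div_assoc]
  have hcard : (Fintype.card V : ℝ) - 1 ≠ 0 := by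
    simpa [sub_eq_zero] using (Fintype.one_lt_card (α := V)).ne'
  rw [kemeny, ENNReal.toReal_sum fun v _ => ENNReal.mul_ne_top
    (hittingTime_eq_treeHittingTime hG u v ▸ ENNReal.ofReal_ne_top) (PMF.apply_ne_top _ v)]
  simp only [hterm, ← Finset.sum_div, sum_treeHittingTime_mul_degree hG]
  field_simp
  ring

variable {W : Type*} [Fintype W] {H : SimpleGraph W}

theorem averageHittingTime_le_iff (hG : G.IsTree) (hH : H.IsTree)
    (hcard : Fintype.card V = Fintype.card W) :
    G.averageHittingTime ≤ H.averageHittingTime ↔ totalDist G ≤ totalDist H := by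
  rw [← ENNReal.toReal_le_toReal (averageHittingTime_lt_top hG).ne
    (averageHittingTime_lt_top hH).ne, toReal_averageHittingTime hG, toReal_averageHittingTime hH,
    hcard]
  rcases subsingleton_or_nontrivial W with hW | hW
  · have : Subsingleton V := (Fintype.card_eq.1 hcard).some.subsingleton
    simp [totalDist_eq_zero_of_subsingleton]
  · have hpos : (0 : ℝ) < Fintype.card W - 1 := by simpa using Fintype.one_lt_card (α := W)
    rw [div_le_div_iff_of_pos_right (by positivity), mul_le_mul_iff_right₀ hpos, Nat.cast_le]

theorem averageHittingTime_eq_iff (hG : G.IsTree) (hH : H.IsTree)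
    (hcard : Fintype.card V = Fintype.card W) :
    G.averageHittingTime = H.averageHittingTime ↔ totalDist G = totalDist H := by
  rw [le_antisymm_iff, le_antisymm_iff, averageHittingTime_le_iff hG hH hcard,
    averageHittingTime_le_iff hH hG hcard.symm]

theorem kemeny_le_iff (hG : G.IsTree) (hH : H.IsTree)
    (hcard : Fintype.card V = Fintype.card W) (u : V) (w : W) :
    G.kemeny u ≤ H.kemeny w ↔ totalDist G ≤ totalDist H := by
  rcases subsingleton_or_nontrivial W with hW | hW
  · have : Subsingleton V := (Fintype.card_eq.1 hcard).some.subsingleton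
    simp [totalDist_eq_zero_of_subsingleton, kemeny_eq_zero_of_subsingleton hG]
  · have : Nontrivial V := (Fintype.card_eq.1 hcard).some.nontrivial
    have hpos : (0 : ℝ) < Fintype.card W - 1 := by simpa using Fintype.one_lt_card (α := W)
    rw [← ENNReal.toReal_le_toReal (kemeny_lt_top hG u).ne (kemeny_lt_top hH w).ne,
      toReal_kemeny hG, toReal_kemeny hH, hcard, add_le_add_iff_right, sub_le_sub_iff_right,
      div_le_div_iff_of_pos_right hpos, Nat.cast_le]

theorem kemeny_eq_iff (hG : G.IsTree) (hH : H.IsTree)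
    (hcard : Fintype.card V = Fintype.card W) (u : V) (w : W) :
    G.kemeny u = H.kemeny w ↔ totalDist G = totalDist H := by
  rw [le_antisymm_iff, le_antisymm_iff, kemeny_le_iff hG hH hcard,
    kemeny_le_iff hH hG hcard.symm]

end TotalDist

section LowerSetRange

variable {α : Type*} [Fintype α]

theorem one_le_card_fiber {β : Type*} [DecidableEq β] (g : α → β) (a : α) :
    1 ≤ #{b | g b = g a} :=
  Finset.card_pos.2 ⟨a, by simp⟩

variable {f : α → ℕ}

theorem le_card_filter_lt_of_isLowerSet_range (hf : IsLowerSet (Set.range f)) (a : α) :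
    f a ≤ #{b | f b < f a} := by
  have hsurj : Set.SurjOn f ({b | f b < f a} : Finset α) (Finset.range (f a)) := by
    intro j hj
    have hj : j < f a := by simpa using hj
    obtain ⟨b, rfl⟩ := hf hj.le ⟨a, rfl⟩
    exact ⟨b, by simpa using hj, rfl⟩
  simpa using Finset.card_le_card_of_surjOn f hsurj

theorem lt_card_of_isLowerSet_range (hf : IsLowerSet (Set.range f)) (a : α) :
    f a < Fintype.card α :=
  (le_card_filter_lt_of_isLowerSet_range hf a).trans_lt <|
    Finset.card_lt_card <| Finset.filter_ssubset.2 ⟨a, Finset.mem_univ a, lt_irrefl _⟩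

theorem two_mul_sum_add_sum_card_fiber_le_card_sq (hf : IsLowerSet (Set.range f)) :
    2 * ∑ a, f a + ∑ a, #{b | f b = f a} ≤ Fintype.card α ^ 2 := by
  have hswap : ∑ a, #{b | f a < f b} = ∑ a, #{b | f b < f a} := by
    simp only [Finset.card_filter]
    exact Finset.sum_comm
  have htrichotomy (a : α) :
      #{b | f b < f a} + #{b | f a < f b} + #{b | f b = f a} = Fintype.card α := by
    simp only [Finset.card_filter, ← Finset.sum_add_distrib, Fintype.card_eq_sum_ones]
    refine Finset.sum_congr rfl fun b _ => ?_
    split_ifs <;> lia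
  calc 2 * ∑ a, f a + ∑ a, #{b | f b = f a}
      ≤ 2 * ∑ a, #{b | f b < f a} + ∑ a, #{b | f b = f a} := by
        gcongr with a
        exact le_card_filter_lt_of_isLowerSet_range hf a
    _ = ∑ a, (#{b | f b < f a} + #{b | f a < f b} + #{b | f b = f a}) := by
        rw [Finset.sum_add_distrib, Finset.sum_add_distrib, hswap, two_mul]
    _ = Fintype.card α ^ 2 := by simp [htrichotomy, sq]

theorem two_mul_sum_add_card_le_card_sq (hf : IsLowerSet (Set.range f)) :
    2 * ∑ a, f a + Fintype.card α ≤ Fintype.card α ^ 2 := by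
  refine le_trans ?_ (two_mul_sum_add_sum_card_fiber_le_card_sq hf)
  rw [Fintype.card_eq_sum_ones]
  gcongr with a
  exact one_le_card_fiber f a

theorem injective_of_card_sq_le (hf : IsLowerSet (Set.range f))
    (h : Fintype.card α ^ 2 ≤ 2 * ∑ a, f a + Fintype.card α) : Function.Injective f := by
  intro a b hab
  by_contra hne
  have hlt : ∑ _a : α, 1 < ∑ a, #{b | f b = f a} :=
    Finset.sum_lt_sum (fun a _ => one_le_card_fiber f a) ⟨a, Finset.mem_univ a,
      Finset.one_lt_card.2 ⟨a, by simp, b, by simp [hab], hne⟩⟩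
  rw [← Fintype.card_eq_sum_ones] at hlt
  have hle := two_mul_sum_add_sum_card_fiber_le_card_sq hf
  lia

end LowerSetRange

section Distance

variable {V W : Type*} {G : SimpleGraph V} {H : SimpleGraph W}

theorem dist_map_le (hG : G.Connected) (f : G →g H) (u v : V) :
    H.dist (f u) (f v) ≤ G.dist u v := by
  obtain ⟨p, hp⟩ := hG.exists_walk_length_eq_dist u v
  exact (dist_le (p.map f)).trans_eq ((p.length_map f).trans hp)

theorem totalDist_eq_of_iso [Fintype V] [Fintype W] (hG : G.Connected) (e : G ≃g H) :
    totalDist G = totalDist H := by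
  have hdist (u v : V) : G.dist u v = H.dist (e u) (e v) :=
    le_antisymm (by simpa using dist_map_le (e.connected_iff.1 hG) e.symm.toHom (e u) (e v))
      (dist_map_le hG e.toHom u v)
  exact Fintype.sum_equiv e.toEquiv _ _ fun u => Fintype.sum_equiv e.toEquiv _ _ (hdist u)

theorem le_add_dist_of_forall_adj (hG : G.Connected) {f : V → ℕ}
    (hf : ∀ u v, G.Adj u v → f u ≤ f v + 1) (u v : V) : f u ≤ f v + G.dist u v := by
  obtain ⟨p, hp⟩ := hG.exists_walk_length_eq_dist u v
  rw [← hp]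
  clear hp
  induction p with
  | nil => simp
  | cons h p ih => grind [hf _ _ h, Walk.length_cons]

theorem isLowerSet_range_dist (hG : G.Connected) (w : V) : IsLowerSet (Set.range (G.dist w)) := by
  rintro m n hnm hm
  induction hnm using Nat.decreasingInduction with
  | self => exact hm
  | of_succ k _ ih =>
    obtain ⟨u, hu⟩ := ih
    have hne : u ≠ w := by
      rintro rfl
      simp at hu
    obtain ⟨x, -, hx⟩ := exists_adj_dist_eq_add_one hG hne
    exact ⟨x, by lia⟩

end Distance

section Path

theorem isTree_pathGraph {n : ℕ} (hn : n ≠ 0) : (pathGraph n).IsTree := by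
  obtain ⟨m, rfl⟩ := Nat.exists_eq_succ_of_ne_zero hn
  have hconn := pathGraph_connected m
  have hedges : (pathGraph (m + 1)).edgeSet ⊆ Set.range fun i : Fin m => s(i.castSucc, i.succ) := by
    refine Sym2.ind fun u v huv => ?_
    rcases pathGraph_adj.1 huv with h | h
    · exact ⟨⟨u, by lia⟩, Sym2.eq_iff.2 (Or.inl ⟨rfl, Fin.ext h⟩)⟩
    · exact ⟨⟨v, by lia⟩, Sym2.eq_iff.2 (Or.inr ⟨rfl, Fin.ext h⟩)⟩
  have hle : Nat.card (pathGraph (m + 1)).edgeSet ≤ m :=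
    (Nat.card_mono (Set.finite_range _) hedges).trans <| by
      simpa using Finite.card_range_le fun i : Fin m => s(i.castSucc, i.succ)
  have hge := hconn.card_vert_le_card_edgeSet_add_one
  rw [Nat.card_fin] at hge
  refine isTree_iff_connected_and_card.2 ⟨hconn, ?_⟩
  rw [Nat.card_fin]
  lia

variable {V : Type*} [Fintype V] {G : SimpleGraph V}

theorem nonempty_iso_pathGraph_of_injective_dist (hG : G.Connected) {w : V}
    (hinj : Function.Injective (G.dist w)) : Nonempty (G ≃g pathGraph (Fintype.card V)) := by
  have hlt := lt_card_of_isLowerSet_range (isLowerSet_range_dist hG w)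
  have hbij : Function.Bijective fun u => (⟨G.dist w u, hlt u⟩ : Fin (Fintype.card V)) :=
    (Fintype.bijective_iff_injective_and_card _).2
      ⟨fun x y hxy => hinj (Fin.ext_iff.1 hxy), by simp⟩
  have hadj {x y : V} (hxy : G.dist w x + 1 = G.dist w y) : G.Adj x y := by
    have hy : y ≠ w := by
      rintro rfl
      simp at hxy
    obtain ⟨z, hz, hzd⟩ := exists_adj_dist_eq_add_one hG hy
    exact hinj (show G.dist w z = G.dist w x by lia) ▸ hz
  refine ⟨⟨Equiv.ofBijective _ hbij, fun {x y} => pathGraph_adj.trans ⟨?_, fun h => ?_⟩⟩⟩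
  · rintro (h | h)
    exacts [hadj h, (hadj h).symm]
  · have hne : G.dist w x ≠ G.dist w y := hinj.ne h.ne
    rcases h.diff_dist_adj (u := w) with h | h | h
    exacts [absurd h.symm hne, Or.inl h.symm, Or.inr (by simp; lia)]

theorem totalDist_le_totalDist_induce_add (v : V) [Fintype ({v}ᶜ : Set V)]
    (hv : (G.induce {v}ᶜ).Connected) :
    totalDist G ≤ totalDist (G.induce {v}ᶜ) + 2 * ∑ u, G.dist v u := by
  classical
  have hsplit (f : V → ℕ) : ∑ u, f u = f v + ∑ u : ({v}ᶜ : Set V), f u :=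
    (Finset.add_sum_erase _ f (Finset.mem_univ v)).symm.trans
      (congrArg _ (Finset.sum_subtype _ (by simp) f))
  have hinduce (u w : ({v}ᶜ : Set V)) : G.dist u w ≤ (G.induce {v}ᶜ).dist u w :=
    dist_map_le hv (Embedding.induce {v}ᶜ).toHom u w
  calc totalDist G
      = ∑ u, G.dist v u +
          ∑ u : ({v}ᶜ : Set V), (G.dist v u + ∑ w : ({v}ᶜ : Set V), G.dist u w) := by
        rw [totalDist, hsplit fun u => ∑ w, G.dist u w]
        simp only [hsplit (G.dist _), dist_comm (v := v)]
    _ = 2 * ∑ u, G.dist v u + ∑ u : ({v}ᶜ : Set V), ∑ w : ({v}ᶜ : Set V), G.dist u w := by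
        rw [Finset.sum_add_distrib, hsplit (G.dist v), SimpleGraph.dist_self]
        ring
    _ ≤ totalDist (G.induce {v}ᶜ) + 2 * ∑ u, G.dist v u := by
        rw [add_comm]
        gcongr
        exact Finset.sum_le_sum fun u _ => Finset.sum_le_sum fun w _ => hinduce u w

theorem three_mul_totalDist_add_card_le_card_pow_three (hG : G.Connected) :
    3 * totalDist G + Fintype.card V ≤ Fintype.card V ^ 3 := by
  classical
  induction hn : Fintype.card V generalizing V with
  | zero => exact absurd hn (Fintype.card_pos_iff.2 hG.nonempty).ne'
  | succ m ih =>
    rcases subsingleton_or_nontrivial V with hV | hV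
    · rw [totalDist_eq_zero_of_subsingleton, mul_zero, zero_add]
      exact Nat.le_self_pow three_ne_zero _
    · obtain ⟨v, hv⟩ := hG.exists_connected_induce_compl_singleton_of_finite_nontrivial
      have hsum := two_mul_sum_add_card_le_card_sq (isLowerSet_range_dist hG v)
      have hdelete := totalDist_le_totalDist_induce_add v hv
      have hinduce := ih hv (by rw [Fintype.card_compl_set, hn, Set.card_singleton]; rfl)
      rw [hn] at hsum
      nlinarith

theorem nonempty_iso_pathGraph_of_card_pow_three_le (hG : G.Connected)
    (h : Fintype.card V ^ 3 ≤ 3 * totalDist G + Fintype.card V) :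
    Nonempty (G ≃g pathGraph (Fintype.card V)) := by
  classical
  rcases subsingleton_or_nontrivial V with hV | hV
  · obtain ⟨v⟩ := hG.nonempty
    exact nonempty_iso_pathGraph_of_injective_dist hG (w := v)
      (Function.injective_of_subsingleton _)
  · obtain ⟨v, hv⟩ := hG.exists_connected_induce_compl_singleton_of_finite_nontrivial
    refine nonempty_iso_pathGraph_of_injective_dist hG (w := v)
      (injective_of_card_sq_le (isLowerSet_range_dist hG v) ?_)
    have hdelete := totalDist_le_totalDist_induce_add v hv
    have hinduce := three_mul_totalDist_add_card_le_card_pow_three hv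
    have hcard : Fintype.card V = Fintype.card ({v}ᶜ : Set V) + 1 := by
      rw [Fintype.card_compl_set, Set.card_singleton, Nat.sub_add_cancel Fintype.card_pos]
    rw [hcard] at h ⊢
    nlinarith

theorem three_mul_sum_sum_absDiff_add (n : ℕ) :
    3 * ∑ i ∈ Finset.range n, ∑ j ∈ Finset.range n, ((i - j) + (j - i)) + n = n ^ 3 := by
  induction n with
  | zero => simp
  | succ n ih =>
    have hlast : (∑ j ∈ Finset.range n, ((n - j) + (j - n))) * 2 = (n + 1) * n := by
      have hgauss := Finset.sum_range_id_mul_two (n + 1)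
      rw [← Finset.sum_range_reflect, Finset.sum_range_succ] at hgauss
      have hdiff : ∀ j ∈ Finset.range n, (n - j) + (j - n) = n + 1 - 1 - j := fun j hj => by
        have := Finset.mem_range.1 hj
        lia
      rw [Finset.sum_congr rfl hdiff]
      simpa using hgauss
    have hcomm (i : ℕ) : (i - n) + (n - i) = (n - i) + (i - n) := add_comm _ _
    simp only [Finset.sum_range_succ, Finset.sum_add_distrib (f := fun _ => ∑ _ ∈ _, _), hcomm,
      Nat.sub_self]
    linear_combination ih + 3 * hlast

theorem three_mul_totalDist_pathGraph_add {n : ℕ} (hn : n ≠ 0) :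
    3 * totalDist (pathGraph n) + n = n ^ 3 := by
  have hconn := (isTree_pathGraph hn).connected
  refine le_antisymm (by simpa using three_mul_totalDist_add_card_le_card_pow_three hconn) ?_
  have hle (i j : Fin n) : (i : ℕ) ≤ j + (pathGraph n).dist i j :=
    le_add_dist_of_forall_adj hconn (fun u v huv => by rw [pathGraph_adj] at huv; lia) i j
  have hdist (i j : Fin n) : (i - j : ℕ) + (j - i) ≤ (pathGraph n).dist i j := by
    have hij := hle i j
    have hji := hle j i
    rw [dist_comm] at hji
    lia
  rw [← three_mul_sum_sum_absDiff_add n]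
  simp only [Finset.sum_range, totalDist]
  gcongr
  exact hdist _ _

theorem totalDist_le_totalDist_pathGraph (hG : G.Connected) :
    totalDist G ≤ totalDist (pathGraph (Fintype.card V)) := by
  have := hG.nonempty
  have hpath := three_mul_totalDist_pathGraph_add (n := Fintype.card V) Fintype.card_ne_zero
  have hle := three_mul_totalDist_add_card_le_card_pow_three hG
  lia

theorem totalDist_eq_totalDist_pathGraph_iff (hG : G.Connected) :
    totalDist G = totalDist (pathGraph (Fintype.card V)) ↔
      Nonempty (G ≃g pathGraph (Fintype.card V)) := by
  have := hG.nonempty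
  refine ⟨fun h => nonempty_iso_pathGraph_of_card_pow_three_le hG ?_,
    fun ⟨e⟩ => totalDist_eq_of_iso hG e⟩
  rw [h, three_mul_totalDist_pathGraph_add Fintype.card_ne_zero]

end Path

section Star

variable {V : Type*} {G : SimpleGraph V}

theorem two_le_dist_add_ite_add_ite [DecidableEq V] [DecidableRel G.Adj] (hG : G.Connected)
    (u v : V) :
    2 ≤ G.dist u v + (if G.Adj u v then 1 else 0) + (if u = v then 2 else 0) := by
  split_ifs with hadj heq heq
  · exact absurd heq hadj.ne
  · rw [dist_eq_one_iff_adj.2 hadj]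
  · lia
  · exact hG.one_lt_dist_of_ne_of_not_adj heq hadj

theorem two_eq_dist_add_ite_add_ite_iff [DecidableEq V] [DecidableRel G.Adj] (hG : G.Connected)
    (u v : V) :
    2 = G.dist u v + (if G.Adj u v then 1 else 0) + (if u = v then 2 else 0) ↔
      G.dist u v ≤ 2 := by
  split_ifs with hadj heq heq
  · exact absurd heq hadj.ne
  · simp [dist_eq_one_iff_adj.2 hadj]
  · simp [heq]
  · have := hG.one_lt_dist_of_ne_of_not_adj heq hadj
    lia

theorem exists_forall_adj_of_dist_le_two [Finite V] (hG : G.IsTree)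
    (h : ∀ u v, G.dist u v ≤ 2) : ∃ c, ∀ x, x ≠ c → G.Adj c x := by
  classical
  have := Fintype.ofFinite V
  rcases subsingleton_or_nontrivial V with hV | hV
  · obtain ⟨c⟩ := hG.connected.nonempty
    exact ⟨c, fun x hx => absurd (Subsingleton.elim x c) hx⟩
  obtain ⟨l, hl⟩ := hG.exists_vert_degree_one_of_nontrivial
  obtain ⟨c, hlc, hc⟩ := degree_eq_one_iff_existsUnique_adj.1 hl
  refine ⟨c, fun x hx => ?_⟩
  rcases eq_or_ne l x with rfl | hlx
  · exact hlc.symm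
  obtain ⟨y, hy, hdist⟩ := exists_adj_dist_eq_add_one hG.connected hlx
  obtain rfl := hc y hy.symm
  have hpos := hG.connected.pos_dist_of_ne hx
  exact (dist_eq_one_iff_adj.1 (by have := h x l; lia)).symm

theorem nonempty_starGraph_iso (c r : V) : Nonempty (starGraph c ≃g starGraph r) := by
  classical
  have hcenter (z : V) : Equiv.swap c r z = r ↔ z = c := by
    rw [Equiv.swap_apply_eq_iff, Equiv.swap_apply_right]
  refine ⟨⟨Equiv.swap c r, fun {x y} => ?_⟩⟩
  rw [starGraph_adj, starGraph_adj, hcenter, hcenter, (Equiv.swap c r).injective.ne_iff]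

theorem nonempty_iso_starGraph_of_dist_le_two [Finite V] (hG : G.IsTree)
    (h : ∀ u v, G.dist u v ≤ 2) (r : V) : Nonempty (G ≃g starGraph r) := by
  obtain ⟨c, hc⟩ := exists_forall_adj_of_dist_le_two hG h
  have hle : starGraph c ≤ G := fun x y hxy => by
    obtain ⟨hne, rfl | rfl⟩ := starGraph_adj.1 hxy
    exacts [hc y hne.symm, (hc x hne).symm]
  obtain rfl : starGraph c = G :=
    (isTree_iff_minimal_connected.1 hG).eq_of_le (connected_starGraph c) hle
  exact nonempty_starGraph_iso c r

theorem dist_starGraph_le_two (r u v : V) : (starGraph r).dist u v ≤ 2 := by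
  have hcenter (x : V) : (starGraph r).dist r x ≤ 1 := by
    rcases eq_or_ne r x with rfl | hx
    · simp
    · exact (dist_eq_one_iff_adj.2 (starGraph_center_adj hx)).le
  calc (starGraph r).dist u v
      ≤ (starGraph r).dist u r + (starGraph r).dist r v := (connected_starGraph r).dist_triangle
    _ ≤ 1 + 1 := add_le_add (dist_comm.trans_le (hcenter u)) (hcenter v)

variable [Fintype V]

theorem sum_sum_dist_add_ite_add_ite [DecidableEq V] [DecidableRel G.Adj] :
    ∑ u, ∑ v, (G.dist u v + (if G.Adj u v then 1 else 0) + (if u = v then 2 else 0)) =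
      totalDist G + ∑ u, G.degree u + 2 * Fintype.card V := by
  have hdegree (u : V) : ∑ v, (if G.Adj u v then 1 else 0) = G.degree u := by
    simpa using (degree_eq_sum_if_adj (R := ℕ) G u).symm
  simp [Finset.sum_add_distrib, hdegree, totalDist, mul_comm]

theorem two_mul_card_sq_le [DecidableRel G.Adj] (hG : G.Connected) :
    2 * Fintype.card V ^ 2 ≤ totalDist G + ∑ u, G.degree u + 2 * Fintype.card V := by
  classical
  calc 2 * Fintype.card V ^ 2 = ∑ _u : V, ∑ _v : V, 2 := by simp; ring
    _ ≤ _ := Finset.sum_le_sum fun u _ => Finset.sum_le_sum fun v _ =>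
      two_le_dist_add_ite_add_ite hG u v
    _ = _ := sum_sum_dist_add_ite_add_ite

theorem two_mul_card_sq_eq_iff [DecidableRel G.Adj] (hG : G.Connected) :
    2 * Fintype.card V ^ 2 = totalDist G + ∑ u, G.degree u + 2 * Fintype.card V ↔
      ∀ u v, G.dist u v ≤ 2 := by
  classical
  have hterm (u v : V) := two_le_dist_add_ite_add_ite hG u v
  have hcard : 2 * Fintype.card V ^ 2 = ∑ _u : V, ∑ _v : V, 2 := by simp; ring
  rw [hcard, ← sum_sum_dist_add_ite_add_ite,
    Finset.sum_eq_sum_iff_of_le fun u _ => Finset.sum_le_sum fun v _ => hterm u v]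
  simp only [Finset.mem_univ, true_imp_iff]
  refine forall_congr' fun u => ?_
  rw [Finset.sum_eq_sum_iff_of_le fun v _ => hterm u v]
  simp only [Finset.mem_univ, true_imp_iff, two_eq_dist_add_ite_add_ite_iff hG]

theorem totalDist_starGraph_add_sum_degree_add [DecidableRel G.Adj] (hG : G.IsTree) (r : V) :
    totalDist (starGraph r) + ∑ u, G.degree u + 2 * Fintype.card V = 2 * Fintype.card V ^ 2 := by
  classical
  have hdegree : ∑ u, G.degree u = ∑ u, (starGraph r).degree u := by
    exact_mod_cast (sum_degree_eq hG).trans (sum_degree_eq (isTree_starGraph r)).symm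
  rw [hdegree, (two_mul_card_sq_eq_iff (connected_starGraph r)).2 (dist_starGraph_le_two r)]

theorem totalDist_starGraph_le (hG : G.IsTree) (r : V) :
    totalDist (starGraph r) ≤ totalDist G := by
  classical
  have hstar := totalDist_starGraph_add_sum_degree_add hG r
  have hle := two_mul_card_sq_le hG.connected
  lia

theorem totalDist_starGraph_eq_iff (hG : G.IsTree) (r : V) :
    totalDist (starGraph r) = totalDist G ↔ Nonempty (G ≃g starGraph r) := by
  classical
  refine ⟨fun h => ?_, fun ⟨e⟩ => (totalDist_eq_of_iso hG.connected e).symm⟩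
  have hstar := totalDist_starGraph_add_sum_degree_add hG r
  exact nonempty_iso_starGraph_of_dist_le_two hG
    ((two_mul_card_sq_eq_iff hG.connected).1 (by rw [← hstar, h])) r

end Star

end TreeWalk

theorem theorem1 {V : Type*} [Fintype V] (T : SimpleGraph V) (hT : T.IsTree) (r : V) :
    -- the path has the largest average hitting time, and is the only tree that attains it
    (SimpleGraph.pathGraph (Fintype.card V)).averageHittingTime < ∞ ∧
    T.averageHittingTime ≤ (SimpleGraph.pathGraph (Fintype.card V)).averageHittingTime ∧
    (T.averageHittingTime = (SimpleGraph.pathGraph (Fintype.card V)).averageHittingTime ↔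
      Nonempty (T ≃g SimpleGraph.pathGraph (Fintype.card V))) ∧
    -- the star has the smallest average hitting time, and is the only tree that attains it
    (SimpleGraph.starGraph r).averageHittingTime ≤ T.averageHittingTime ∧
    ((SimpleGraph.starGraph r).averageHittingTime = T.averageHittingTime ↔
      Nonempty (T ≃g SimpleGraph.starGraph r)) ∧
    -- Kemeny's constant does not depend on the starting vertex
    (∀ u u' : V, T.kemeny u = T.kemeny u') ∧
    -- the path has the largest Kemeny's constant, and is the only tree that attains it
    (∀ p : Fin (Fintype.card V), (SimpleGraph.pathGraph (Fintype.card V)).kemeny p < ∞) ∧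
    (∀ (u : V) (p : Fin (Fintype.card V)),
      T.kemeny u ≤ (SimpleGraph.pathGraph (Fintype.card V)).kemeny p ∧
      (T.kemeny u = (SimpleGraph.pathGraph (Fintype.card V)).kemeny p ↔
        Nonempty (T ≃g SimpleGraph.pathGraph (Fintype.card V)))) ∧
    -- the star has the smallest Kemeny's constant, and is the only tree that attains it
    (∀ u s : V,
      (SimpleGraph.starGraph r).kemeny s ≤ T.kemeny u ∧
      ((SimpleGraph.starGraph r).kemeny s = T.kemeny u ↔
        Nonempty (T ≃g SimpleGraph.starGraph r))) := by
  have : Nonempty V := ⟨r⟩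
  have hP := TreeWalk.isTree_pathGraph (n := Fintype.card V) Fintype.card_ne_zero
  have hS := SimpleGraph.isTree_starGraph r
  have hcard : Fintype.card V = Fintype.card (Fin (Fintype.card V)) := (Fintype.card_fin _).symm
  have hmax := TreeWalk.totalDist_le_totalDist_pathGraph hT.connected
  have hmax_iff := TreeWalk.totalDist_eq_totalDist_pathGraph_iff hT.connected
  have hmin := TreeWalk.totalDist_starGraph_le hT r
  have hmin_iff := TreeWalk.totalDist_starGraph_eq_iff hT r
  exact ⟨TreeWalk.averageHittingTime_lt_top hP,
    (TreeWalk.averageHittingTime_le_iff hT hP hcard).2 hmax,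
    (TreeWalk.averageHittingTime_eq_iff hT hP hcard).trans hmax_iff,
    (TreeWalk.averageHittingTime_le_iff hS hT rfl).2 hmin,
    (TreeWalk.averageHittingTime_eq_iff hS hT rfl).trans hmin_iff,
    fun u u' => (TreeWalk.kemeny_eq_iff hT hT rfl u u').2 rfl,
    TreeWalk.kemeny_lt_top hP,
    fun u p => ⟨(TreeWalk.kemeny_le_iff hT hP hcard u p).2 hmax,
      (TreeWalk.kemeny_eq_iff hT hP hcard u p).trans hmax_iff⟩,
    fun u s => ⟨(TreeWalk.kemeny_le_iff hS hT rfl s u).2 hmin,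
      (TreeWalk.kemeny_eq_iff hS hT rfl s u).trans hmin_iff⟩⟩
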